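/- Let $G$ be a finite group. Write $g^x = x^{-1}gx$, and let $d(G)$ denote the minimal number of generators of $G$. A subset $\{g_1,\dots,g_u\}$ of $G$ is said to invariably generate $G$ if $\{g_1^{x_1},\dots,g_u^{x_u}\}$ generates $G$ for every choice of $x_1,\dots,x_u\in G$. The group $G$ is called coprimely invariably generated if there is a subset $\{g_1,\dots,g_u\}$ that invariably generates $G$ and whose elements have pairwise coprime orders $|g_1|,\dots,|g_u|$. If $G$ is soluble and coprimely invariably generated, then $d(G)\le 2$. -/

import Mathlib

/-- A subset `S` of a group `G` invariably generates `G` if replacing each `g ∈ S` by an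
arbitrary conjugate `g ^ (x g) = (x g)⁻¹ * g * x g` always yields a generating set of `G`. -/
def InvariablyGenerates {G : Type*} [Group G] (S : Set G) : Prop :=
  ∀ x : G → G, Subgroup.closure ((fun g => (x g)⁻¹ * g * x g) '' S) = ⊤

/-- A (finite) group is coprimely invariably generated if it has a finite invariable generating
set whose distinct elements have pairwise coprime orders. -/
def IsCoprimelyInvariablyGenerated (G : Type*) [Group G] : Prop :=
  ∃ S : Finset G, InvariablyGenerates (S : Set G) ∧
    (S : Set G).Pairwise fun g h => (orderOf g).Coprime (orderOf h)

/-! ### Coprime invariable generation passes to quotients -/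

/-! Induct on |G|. Let N be minimal normal, viewed as an irreducible module V of exponent p, and let
aN, bN generate G/N. If no pair (am, bn) with m, n in N generates G, each of these |V|^2 pairs
generates a complement of N. Each complement yields a derivation G → V that is the identity on N,
and distinct pairs yield distinct derivations; with zero there are more than |V|^2. Coprimality
gives the opposite bound, `card_derivations_le`. Up to inner derivations, every derivation lies in a
set E whose common zeros K satisfy G = KC, where C is the kernel of the action. Elements of order
prime to p are conjugate into K, and at most one generator has order divisible by p. So a member of
E is determined by one value, whence |E| ≤ |V| and |Der(G, V)| ≤ |V|^2. -/

theorem IsCoprimelyInvariablyGenerated.of_surjective {G H : Type*} [Group G] [Group H]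
    (f : G →* H) (hf : Function.Surjective f) (hG : IsCoprimelyInvariablyGenerated G) :
    IsCoprimelyInvariablyGenerated H := by
  classical
  obtain ⟨S, hS, hcop⟩ := hG
  refine ⟨S.image f, fun x => ?_, ?_⟩
  · choose s hs using hf
    have h := congrArg (Subgroup.map f) (hS fun g => s (x (f g)))
    rw [MonoidHom.map_closure, Subgroup.map_top_of_surjective f fun y => ⟨s y, hs y⟩] at h
    rw [← h, Finset.coe_image, Set.image_image, Set.image_image]
    simp [hs]
  · rw [Finset.coe_image]
    rintro _ ⟨g, hg, rfl⟩ _ ⟨h, hh, rfl⟩ hne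
    exact Nat.Coprime.of_dvd (orderOf_map_dvd f g) (orderOf_map_dvd f h)
      (hcop hg hh fun e => hne (e ▸ rfl))

/-! ### Minimal normal subgroups of soluble groups -/

/-- A nontrivial finite soluble group has a minimal normal subgroup, and it is an elementary
abelian `p`-group. -/
theorem exists_minimal_normal_elementary_abelian (G : Type*) [Group G] [Finite G]
    [Group.IsSolvable G] [Nontrivial G] :
    ∃ (N : Subgroup G) (p : ℕ), N.Normal ∧ p.Prime ∧ N ≠ ⊥ ∧ IsMulCommutative N ∧
      (∀ n ∈ N, n ^ p = 1) ∧ ∀ M : Subgroup G, M.Normal → M ≤ N → M = ⊥ ∨ M = N := by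
  obtain ⟨N, hN⟩ := exists_minimal_of_wellFoundedLT (fun M : Subgroup G => M.Normal ∧ M ≠ ⊥)
    ⟨⊤, inferInstance, bot_ne_top.symm⟩
  obtain ⟨⟨hnorm, hbot⟩, hmin⟩ := hN
  have hmin' : ∀ M : Subgroup G, M.Normal → M ≤ N → M = ⊥ ∨ M = N := fun M hM hle =>
    or_iff_not_imp_left.2 fun h => le_antisymm hle (hmin ⟨hM, h⟩ hle)
  have hlt : ⁅N, N⁆ < N := Group.IsSolvable.commutator_lt_of_ne_bot hbot
  have hcomm : ⁅N, N⁆ = ⊥ :=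
    (hmin' _ (Subgroup.commutator_normal N N) hlt.le).resolve_right hlt.ne
  have hab : ∀ a ∈ N, ∀ b ∈ N, a * b = b * a := fun a ha b hb =>
    ((Subgroup.mem_centralizer_iff.1
      (Subgroup.commutator_eq_bot_iff_le_centralizer.1 hcomm ha)) b hb).symm
  have hcard : Nat.card N ≠ 1 := fun h => hbot (Subgroup.card_eq_one.1 h)
  obtain ⟨p, hp, hdvd⟩ := Nat.exists_prime_and_dvd hcard
  have : Fact p.Prime := ⟨hp⟩
  obtain ⟨z, hz⟩ := exists_prime_orderOf_dvd_card' p hdvd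
  let T : Subgroup G :=
    { carrier := {x | x ∈ N ∧ x ^ p = 1}
      one_mem' := ⟨N.one_mem, one_pow p⟩
      mul_mem' := fun {a b} ha hb =>
        ⟨N.mul_mem ha.1 hb.1, by
          rw [(show Commute a b from hab a ha.1 b hb.1).mul_pow, ha.2, hb.2, one_mul]⟩
      inv_mem' := fun {a} ha => ⟨N.inv_mem ha.1, by rw [inv_pow, ha.2, inv_one]⟩ }
  have hT : T.Normal :=
    ⟨fun x hx g => ⟨hnorm.conj_mem x hx.1 g, by rw [conj_pow, hx.2]; group⟩⟩
  have hTN : T = N := by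
    refine (hmin' T hT fun x hx => hx.1).resolve_left fun h => ?_
    have hzT : (z : G) ∈ T := ⟨z.2, by rw [← Subgroup.coe_pow, ← hz, pow_orderOf_eq_one]; rfl⟩
    rw [h, Subgroup.mem_bot, OneMemClass.coe_eq_one] at hzT
    rw [hzT, orderOf_one] at hz
    exact hp.one_lt.ne hz
  exact ⟨N, p, hnorm, hp, hbot, IsMulCommutative.of_setLike_mul_comm hab,
    fun n hn => ((hTN ▸ hn : n ∈ T)).2, hmin'⟩

/-- A Frattini argument: a Sylow `q`-subgroup of `L` supplements `C` in `L`, and its normaliser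
supplements `C` in `G`, when `L / C` has exponent `q`. -/
theorem exists_isPGroup_normalizer_sup_eq_top {G : Type*} [Group G] [Finite G] {q : ℕ}
    (hq : q.Prime) (C L : Subgroup G) [C.Normal] [L.Normal] (hCL : C ≤ L)
    (hL : ∀ x ∈ L, x ^ q ∈ C) :
    ∃ Q : Subgroup G, IsPGroup q Q ∧ L ≤ Q ⊔ C ∧
      Subgroup.normalizer (Q : Set G) ⊔ C = ⊤ := by
  have : Fact q.Prime := ⟨hq⟩
  obtain ⟨P⟩ : Nonempty (Sylow q L) := inferInstance
  have hPG : IsPGroup q (L ⧸ C.subgroupOf L) := by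
    intro x
    induction x using QuotientGroup.induction_on with
    | _ x =>
      refine ⟨1, ?_⟩
      rw [pow_one, ← QuotientGroup.mk_pow, QuotientGroup.eq_one_iff, Subgroup.mem_subgroupOf]
      exact hL x x.2
  obtain ⟨n, hn⟩ := IsPGroup.iff_card.1 hPG
  have htop : (P : Subgroup L) ⊔ C.subgroupOf L = ⊤ := by
    rw [← Subgroup.index_eq_one]
    -- The index of PC in L is a power of q because L/C is a q-group, and prime to q because P is
    -- Sylow.
    have h1 : ((P : Subgroup L) ⊔ C.subgroupOf L).index ∣ q ^ n := by
      rw [← hn, ← Subgroup.index_eq_card]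
      exact Subgroup.index_dvd_of_le le_sup_right
    have h2 : ((P : Subgroup L) ⊔ C.subgroupOf L).index ∣ (P : Subgroup L).index :=
      Subgroup.index_dvd_of_le le_sup_left
    exact Nat.eq_one_of_dvd_coprimes
      (((Nat.Prime.coprime_iff_not_dvd hq).2 P.not_dvd_index).pow_left n) h1 h2
  have hle : L ≤ (P : Subgroup L).map L.subtype ⊔ C := by
    have h := congrArg (Subgroup.map L.subtype) htop
    rw [Subgroup.map_sup, Subgroup.subgroupOf_map_subtype, inf_of_le_left hCL,
      ← MonoidHom.range_eq_map, Subgroup.range_subtype] at h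
    exact h.ge
  refine ⟨(P : Subgroup L).map L.subtype, P.2.map _, hle, ?_⟩
  rw [← top_le_iff, ← P.normalizer_sup_eq_top]
  exact sup_le le_sup_left (hle.trans (sup_le_sup_right Subgroup.le_normalizer C))

/-! ### Derivations into a module -/

section Derivations

variable {G V : Type*} [Group G] [AddCommGroup V] [DistribMulAction G V]

variable (G V) in
/-- The group of derivations (crossed homomorphisms) `G → V`. -/
def derivations : AddSubgroup (G → V) where
  carrier := {d | ∀ x y, d (x * y) = d x + x • d y}
  zero_mem' := fun x y => by simp
  add_mem' := fun {d e} hd he x y => by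
    simp only [Pi.add_apply, hd x y, he x y, smul_add]; abel
  neg_mem' := fun {d} hd x y => by simp only [Pi.neg_apply, hd x y, smul_neg]; abel

variable {d : G → V}

theorem derivations.map_mul (hd : d ∈ derivations G V) (x y : G) :
    d (x * y) = d x + x • d y :=
  hd x y

theorem derivations.map_one (hd : d ∈ derivations G V) : d 1 = 0 := by
  have h := derivations.map_mul hd 1 1
  rw [one_smul, mul_one] at h
  exact left_eq_add.1 h

theorem derivations.map_inv (hd : d ∈ derivations G V) (x : G) : d x⁻¹ = -(x⁻¹ • d x) := by
  have h := derivations.map_mul hd x⁻¹ x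
  rw [inv_mul_cancel, derivations.map_one hd] at h
  exact eq_neg_of_add_eq_zero_left h.symm

/-- The inner derivation attached to `v`. -/
def innerDerivation (v : V) : G → V := fun x => v - x • v

theorem innerDerivation_mem (v : V) : innerDerivation v ∈ derivations G V := fun x y => by
  simp only [innerDerivation, mul_smul, smul_sub]; abel

/-- The elements at which all derivations in `E` vanish. -/
def commonZeros (E : Set (G → V)) (hE : E ⊆ derivations G V) : Subgroup G where
  carrier := {x | ∀ d ∈ E, d x = 0}
  one_mem' := fun d hd => derivations.map_one (hE hd)
  mul_mem' := fun {a b} ha hb d hd => by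
    rw [derivations.map_mul (hE hd), ha d hd, hb d hd, smul_zero, add_zero]
  inv_mem' := fun {a} ha d hd => by
    rw [derivations.map_inv (hE hd), ha d hd, smul_zero, neg_zero]

theorem mem_commonZeros {E : Set (G → V)} {hE : E ⊆ derivations G V} {x : G} :
    x ∈ commonZeros E hE ↔ ∀ d ∈ E, d x = 0 :=
  Iff.rfl

theorem mem_ker_toPermHom {c : G} : c ∈ (MulAction.toPermHom G V).ker ↔ ∀ v : V, c • v = v := by
  rw [MonoidHom.mem_ker, Equiv.ext_iff]; rfl

theorem derivations.map_pow_of_mem_ker (hd : d ∈ derivations G V) {c : G}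
    (hc : c ∈ (MulAction.toPermHom G V).ker) (n : ℕ) : d (c ^ n) = n • d c := by
  induction n with
  | zero => simp [derivations.map_one hd]
  | succ n ih =>
    rw [_root_.pow_succ', derivations.map_mul hd, ih, mem_ker_toPermHom.1 hc, succ_nsmul']

/-- Multiplication by a number prime to the exponent is invertible. -/
theorem exists_nsmul_nsmul_eq {p m : ℕ} (hp : p.Prime) (hV : ∀ v : V, p • v = 0)
    (hm : m.Coprime p) : ∃ t : ℕ, ∀ v : V, t • m • v = v := by
  obtain ⟨t, -, ht⟩ := Nat.exists_mul_mod_eq_one_of_coprime hm hp.one_lt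
  refine ⟨t, fun v => ?_⟩
  rw [← mul_nsmul, ← Nat.div_add_mod (m * t) p, ht, add_nsmul, one_nsmul, mul_nsmul, hV,
    smul_zero, zero_add]

/-- The values of a derivation on a finite subgroup of order prime to the exponent of `V` are
those of an inner derivation. -/
theorem derivations.exists_eq_innerDerivation {p : ℕ} (hp : p.Prime) (hV : ∀ v : V, p • v = 0)
    (Q : Subgroup G) [Finite Q] (hQ : (Nat.card Q).Coprime p) (hd : d ∈ derivations G V) :
    ∃ v : V, ∀ s ∈ Q, d s = innerDerivation v s := by
  obtain ⟨t, ht⟩ := exists_nsmul_nsmul_eq hp hV hQ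
  have := Fintype.ofFinite Q
  -- The average of d over Q, with t inverting |Q| modulo p.
  refine ⟨t • ∑ s : Q, d s, fun s hs => ?_⟩
  have h : ∑ r : Q, d r = ∑ r : Q, (d s + s • d r) := by
    rw [← Equiv.sum_comp (Equiv.mulLeft (⟨s, hs⟩ : Q)) fun r : Q => d r]
    exact Finset.sum_congr rfl fun r _ => derivations.map_mul hd s r
  rw [Finset.sum_add_distrib, Finset.sum_const, Finset.card_univ, ← Nat.card_eq_fintype_card,
    ← Finset.smul_sum] at h
  have h' : Nat.card Q • d s = ∑ r : Q, d r - s • ∑ r : Q, d r := eq_sub_of_add_eq h.symm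
  rw [innerDerivation, smul_comm s t, ← nsmul_sub, ← h', ht]

/-- If the common zeros `K` of a set of derivations supplement the kernel of the action, then each
element of order prime to the exponent of `V` has a conjugate in `K`. -/
theorem exists_conj_mem_commonZeros {p : ℕ} (hp : p.Prime) (hV : ∀ v : V, p • v = 0)
    {E : Set (G → V)} (hE : E ⊆ derivations G V)
    (hsup : commonZeros E hE ⊔ (MulAction.toPermHom G V).ker = ⊤) {g : G}
    (hg : (orderOf g).Coprime p) : ∃ x : G, x⁻¹ * g * x ∈ commonZeros E hE := by
  set C := (MulAction.toPermHom G V).ker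
  have hsplit : ∀ x : G, ∃ c ∈ C, ∀ d ∈ E, d c = d x := by
    intro x
    have hx : x ∈ C ⊔ commonZeros E hE := by rw [sup_comm, hsup]; trivial
    rw [← SetLike.mem_coe, Subgroup.normal_mul, Set.mem_mul] at hx
    obtain ⟨c, hc, k, hk, rfl⟩ := hx
    exact ⟨c, hc, fun d hd => by
      rw [derivations.map_mul (hE hd), mem_commonZeros.1 hk d hd, smul_zero, add_zero]⟩
  -- Derivations are additive on C, so one element b of C realises the sum of d over the powers of g
  -- for all d in E at once.
  have hsum : ∀ n : ℕ, ∃ b ∈ C, ∀ d ∈ E, d b = ∑ i ∈ Finset.range n, d (g ^ i) := by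
    intro n
    induction n with
    | zero => exact ⟨1, C.one_mem, fun d hd => by simp [derivations.map_one (hE hd)]⟩
    | succ n ih =>
      obtain ⟨b, hb, hb'⟩ := ih
      obtain ⟨c, hc, hc'⟩ := hsplit (g ^ n)
      exact ⟨b * c, C.mul_mem hb hc, fun d hd => by
        rw [derivations.map_mul (hE hd), mem_ker_toPermHom.1 hb, hb' d hd, hc' d hd,
          Finset.sum_range_succ]⟩
  obtain ⟨b, hb, hb'⟩ := hsum (orderOf g)
  obtain ⟨t, ht⟩ := exists_nsmul_nsmul_eq hp hV hg
  refine ⟨b ^ t, mem_commonZeros.2 fun d hd => ?_⟩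
  have hdd := hE hd
  have hbt : b ^ t ∈ C := C.pow_mem hb t
  have hinv : ∀ v : V, (b ^ t)⁻¹ • v = v := mem_ker_toPermHom.1 (C.inv_mem hbt)
  -- Shifting the summation index costs nothing over a full period, as d vanishes at g ^ 0 and at g
  -- ^ |g|.
  have hrec : g • d b = d b - orderOf g • d g := by
    have h : ∀ i, g • d (g ^ i) = d (g ^ (i + 1)) - d g := fun i => by
      rw [_root_.pow_succ', derivations.map_mul hdd]; abel
    have h0 := Finset.sum_range_succ' (fun i => d (g ^ i)) (orderOf g)
    rw [Finset.sum_range_succ, pow_orderOf_eq_one, pow_zero] at h0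
    rw [hb' d hd, Finset.smul_sum, Finset.sum_congr rfl fun i _ => h i, Finset.sum_sub_distrib,
      Finset.sum_const, Finset.card_range, add_right_cancel h0]
  rw [derivations.map_mul hdd, derivations.map_mul hdd, derivations.map_inv hdd, mul_smul, hinv,
    hinv, hinv, derivations.map_pow_of_mem_ker hdd hb, smul_comm g t, hrec, nsmul_sub, ht]
  abel

end Derivations

/-! ### Counting derivations into an irreducible module -/

section Counting

variable {G V : Type*} [Group G] [AddCommGroup V] [DistribMulAction G V]

theorem derivations.eq_of_eqOn_closure {d e : G → V} (hd : d ∈ derivations G V)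
    (he : e ∈ derivations G V) {T : Set G} (hT : Subgroup.closure T = ⊤)
    (h : ∀ x ∈ T, d x = e x) : d = e := by
  have hle : Subgroup.closure T ≤ commonZeros {d - e}
      (Set.singleton_subset_iff.2 (sub_mem hd he)) :=
    (Subgroup.closure_le _).2 fun x hx => mem_commonZeros.2 <| by
      rintro _ rfl
      exact sub_eq_zero.2 (h x hx)
  funext x
  exact sub_eq_zero.1 (mem_commonZeros.1 (hle (hT ▸ Subgroup.mem_top x)) _ rfl)

/-- For `V` an irreducible module of a soluble group, the derivations are
spanned by the inner ones together with a set whose common zeros supplement the kernel of the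
action. -/
theorem exists_supplement_innerDerivation [Finite G] [Group.IsSolvable G] [Finite V] {p : ℕ}
    (hp : p.Prime) (hV : ∀ v : V, p • v = 0)
    (hirr : ∀ W : AddSubgroup V, (∀ g : G, ∀ v ∈ W, g • v ∈ W) → W = ⊥ ∨ W = ⊤) :
    ∃ (E : Set (G → V)) (hE : E ⊆ derivations G V),
      commonZeros E hE ⊔ (MulAction.toPermHom G V).ker = ⊤ ∧
      ∀ d ∈ derivations G V, ∃ v : V, d - innerDerivation v ∈ E := by
  set C := (MulAction.toPermHom G V).ker
  by_cases hCtop : C = ⊤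
  · refine ⟨derivations G V, subset_rfl, by rw [hCtop, sup_top_eq], fun d hd => ⟨0, ?_⟩⟩
    exact sub_mem hd (innerDerivation_mem 0)
  have : Nontrivial (G ⧸ C) := QuotientGroup.nontrivial_iff.2 hCtop
  obtain ⟨M, q, hM, hq, hMbot, -, hMq, -⟩ := exists_minimal_normal_elementary_abelian (G ⧸ C)
  let L : Subgroup G := M.comap (QuotientGroup.mk' C)
  have hCL : C ≤ L := fun c hc => by
    rw [Subgroup.mem_comap, QuotientGroup.mk'_apply, (QuotientGroup.eq_one_iff c).2 hc]
    exact M.one_mem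
  have hLnorm : L.Normal := hM.comap _
  have hLC : ¬ L ≤ C := fun h => hMbot <| (Subgroup.eq_bot_iff_forall M).2 fun y hy => by
    induction y using QuotientGroup.induction_on with
    | _ x => exact (QuotientGroup.eq_one_iff x).2 (h hy)
  -- The fixed points of the normal subgroup L form a submodule, proper because L acts nontrivially.
  have hLfix : ∀ v : V, (∀ x ∈ L, x • v = v) → v = 0 := by
    let W : AddSubgroup V :=
      { carrier := {v | ∀ x ∈ L, x • v = v}
        zero_mem' := fun x _ => smul_zero x
        add_mem' := fun {a b} ha hb x hx => by rw [smul_add, ha x hx, hb x hx]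
        neg_mem' := fun {a} ha x hx => by rw [smul_neg, ha x hx] }
    have hW : W = ⊥ := by
      refine (hirr W fun g v hv x hx => ?_).resolve_right fun h => hLC fun x hx => ?_
      · have h := hv (g⁻¹ * x * g) (by simpa using hLnorm.conj_mem x hx g⁻¹)
        rw [mul_smul, mul_smul, inv_smul_eq_iff] at h
        exact h
      · exact mem_ker_toPermHom.2 fun v => (h ▸ AddSubgroup.mem_top v : v ∈ W) x hx
    exact fun v hv => (AddSubgroup.mem_bot).1 (hW ▸ hv)
  obtain ⟨Q, hQ, hLQ, hnorm⟩ := exists_isPGroup_normalizer_sup_eq_top hq C L hCL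
    fun x hx => (QuotientGroup.eq_one_iff _).1 (hMq _ hx)
  have hQfix : ∀ v : V, (∀ s ∈ Q, s • v = v) → v = 0 := fun v hv => by
    have hle : Q ⊔ C ≤ MulAction.stabilizer G v :=
      sup_le (fun s hs => hv s hs) fun c hc => mem_ker_toPermHom.1 hc v
    exact hLfix v fun x hx => hle (hLQ hx)
  -- Otherwise the p-group Q would fix a nonzero vector of the p-group V.
  have hqp : q ≠ p := by
    rintro rfl
    have : Fact q.Prime := ⟨hq⟩
    have hnt : ∃ v : V, v ≠ 0 := by
      by_contra! h
      exact hCtop ((Subgroup.eq_top_iff' C).2 fun x => mem_ker_toPermHom.2 fun v => by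
        rw [h (x • v), h v])
    obtain ⟨v, hv⟩ := hnt
    have hdvd : q ∣ Nat.card V := addOrderOf_eq_prime (hV v) hv ▸ addOrderOf_dvd_natCard v
    obtain ⟨w, hw, hne⟩ := hQ.exists_fixed_point_of_prime_dvd_card_of_fixed_point V hdvd
      (a := 0) fun s => smul_zero s
    exact hne (hQfix w fun s hs => hw ⟨s, hs⟩).symm
  have hcop : (Nat.card Q).Coprime p := by
    have : Fact q.Prime := ⟨hq⟩
    obtain ⟨n, hn⟩ := IsPGroup.iff_card.1 hQ
    exact hn ▸ ((Nat.coprime_primes hq hp).2 hqp).pow_left n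
  -- If d vanishes on Q and x normalises Q, then d x is fixed by Q, hence zero; so the common zeros
  -- contain the normaliser of Q.
  refine ⟨{d | d ∈ derivations G V ∧ ∀ s ∈ Q, d s = 0}, fun d hd => hd.1, ?_, fun d hd => ?_⟩
  · rw [← top_le_iff, ← hnorm]
    refine sup_le_sup_right (fun x hx => mem_commonZeros.2 fun d hd => ?_) C
    refine hQfix _ fun s hs => ?_
    have hconj : x⁻¹ * s * x ∈ Q := by
      simpa using (Subgroup.mem_normalizer_iff.1 (inv_mem hx) s).1 hs
    have h1 := derivations.map_mul hd.1 s x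
    have h2 := derivations.map_mul hd.1 x (x⁻¹ * s * x)
    rw [hd.2 _ hs, zero_add] at h1
    rw [hd.2 _ hconj, smul_zero, add_zero] at h2
    rw [← h1, ← h2]
    congr 1
    group
  · obtain ⟨v, hv⟩ := derivations.exists_eq_innerDerivation hp hV Q hcop hd
    exact ⟨v, sub_mem hd (innerDerivation_mem v), fun s hs => sub_eq_zero.2 (hv s hs)⟩

/-- There are at most |V| inner derivations, and a member of E is determined by its value at the one
exceptional generator. -/
theorem card_derivations_le [Finite G] [Group.IsSolvable G] [Finite V] {p : ℕ}
    (hp : p.Prime) (hV : ∀ v : V, p • v = 0)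
    (hirr : ∀ W : AddSubgroup V, (∀ g : G, ∀ v ∈ W, g • v ∈ W) → W = ⊥ ∨ W = ⊤)
    (hG : IsCoprimelyInvariablyGenerated G) :
    Nat.card (derivations G V) ≤ Nat.card V ^ 2 := by
  classical
  obtain ⟨E, hE, hsup, hspan⟩ := exists_supplement_innerDerivation hp hV hirr
  obtain ⟨S, hS, hcop⟩ := hG
  obtain ⟨g₀, hg₀⟩ : ∃ g₀ : G, ∀ g ∈ S, g ≠ g₀ → (orderOf g).Coprime p := by
    by_cases h : ∃ g ∈ S, p ∣ orderOf g
    · obtain ⟨g₀, hg₀, hdvd⟩ := h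
      exact ⟨g₀, fun g hg hne => (hcop hg hg₀ hne).coprime_dvd_right hdvd⟩
    · exact ⟨1, fun g hg _ => ((Nat.Prime.coprime_iff_not_dvd hp).2 fun hd => h ⟨g, hg, hd⟩).symm⟩
  -- The exceptional generator stays put; the others are conjugated into the common zeros of E.
  have hx : ∀ g : G, ∃ x : G, if g = g₀ then x = 1 else
      g ∈ S → x⁻¹ * g * x ∈ commonZeros E hE := by
    intro g
    by_cases hg : g = g₀
    · exact ⟨1, by simp [hg]⟩
    by_cases hgS : g ∈ S
    · obtain ⟨x, hx⟩ := exists_conj_mem_commonZeros hp hV hE hsup (hg₀ g hgS hg)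
      exact ⟨x, by simpa [hg] using fun _ => hx⟩
    · exact ⟨1, by simp [hg, hgS]⟩
  choose x hx using hx
  have hinj : Function.Injective fun d : E => (d : G → V) g₀ := by
    intro d e hde
    refine Subtype.ext (derivations.eq_of_eqOn_closure (hE d.2) (hE e.2) (hS x) ?_)
    rintro _ ⟨g, hg, rfl⟩
    have hxg := hx g
    by_cases h : g = g₀
    · subst h
      rw [if_pos rfl] at hxg
      simpa [hxg] using hde
    · rw [if_neg h] at hxg
      have hz := mem_commonZeros.1 (hxg hg)
      exact (hz d d.2).trans (hz e e.2).symm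
  have hsurj : Function.Surjective fun a : V × E =>
      (⟨innerDerivation a.1 + (a.2 : G → V), add_mem (innerDerivation_mem a.1) (hE a.2.2)⟩ :
        derivations G V) := by
    intro d
    obtain ⟨v, hv⟩ := hspan d d.2
    exact ⟨(v, ⟨_, hv⟩), Subtype.ext (add_sub_cancel _ _)⟩
  calc Nat.card (derivations G V) ≤ Nat.card (V × E) := Nat.card_le_card_of_surjective _ hsurj
    _ = Nat.card V * Nat.card E := Nat.card_prod V E
    _ ≤ Nat.card V * Nat.card V :=
        Nat.mul_le_mul_left _ (Nat.card_le_card_of_injective _ hinj)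
    _ = Nat.card V ^ 2 := (sq _).symm

end Counting

/-! ### Lifting generators modulo a minimal normal subgroup -/

section Lifting

open scoped IsMulCommutative

variable {G : Type*} [Group G]

/-- The conjugation action of a group on an abelian normal subgroup, written additively. -/
abbrev conjDistribMulAction (N : Subgroup G) [N.Normal] [IsMulCommutative N] :
    DistribMulAction G (Additive N) where
  smul g v := Additive.ofMul (MulAut.conjNormal g v.toMul)
  one_smul v := by
    change Additive.ofMul (MulAut.conjNormal (1 : G) v.toMul) = v
    rw [_root_.map_one]; rfl
  mul_smul g h v := by
    change Additive.ofMul (MulAut.conjNormal (g * h) v.toMul) = _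
    rw [_root_.map_mul]; rfl
  smul_zero g := congrArg Additive.ofMul (_root_.map_one (MulAut.conjNormal g))
  smul_add g v w := congrArg Additive.ofMul
    (_root_.map_mul (MulAut.conjNormal g) v.toMul w.toMul)

/-- A complement `K` of an abelian normal subgroup `N` is the zero set of a derivation into `N`
that restricts to the identity on `N`. -/
theorem exists_derivation_of_isComplement (N K : Subgroup G) [N.Normal] [IsMulCommutative N]
    (hsup : N ⊔ K = ⊤) (hinf : N ⊓ K = ⊥) :
    letI := conjDistribMulAction N
    ∃ d ∈ derivations G (Additive N),
      (∀ n : N, d n = Additive.ofMul n) ∧ ∀ g, d g = 0 ↔ g ∈ K := by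
  let := conjDistribMulAction N
  have hex : ∀ g : G, ∃ n : N, (n : G)⁻¹ * g ∈ K := fun g => by
    have hg : g ∈ N ⊔ K := hsup ▸ Subgroup.mem_top g
    rw [← SetLike.mem_coe, Subgroup.normal_mul, Set.mem_mul] at hg
    obtain ⟨n, hn, k, hk, rfl⟩ := hg
    exact ⟨⟨n, hn⟩, by simpa using hk⟩
  have huniq : ∀ (g : G) (m n : N), (m : G)⁻¹ * g ∈ K → (n : G)⁻¹ * g ∈ K → m = n := by
    intro g m n hm hn
    have hK : (m : G)⁻¹ * n ∈ K := by
      have := K.mul_mem hm (K.inv_mem hn)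
      simpa [mul_assoc] using this
    have hbot : (m : G)⁻¹ * n ∈ N ⊓ K := ⟨N.mul_mem (N.inv_mem m.2) n.2, hK⟩
    rw [hinf, Subgroup.mem_bot] at hbot
    exact Subtype.ext (inv_mul_eq_one.1 hbot)
  choose f hf using hex
  -- The N-component in the factorisation G = NK.
  refine ⟨fun g => Additive.ofMul (f g), fun g h => ?_, fun n => ?_, fun g => ?_⟩
  · refine congrArg Additive.ofMul (huniq (g * h) (f (g * h)) (f g * MulAut.conjNormal g (f h))
      (hf _) ?_)
    have := K.mul_mem (hf g) (hf h)
    rw [Subgroup.coe_mul, MulAut.conjNormal_apply]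
    have hc : (f g : G) * (g * f h * g⁻¹) = (g * f h * g⁻¹) * f g :=
      setLike_mul_comm (f g).2
        (Subgroup.Normal.conj_mem inferInstance _ (f h).2 g)
    rw [hc]
    convert this using 1
    group
  · exact congrArg Additive.ofMul (huniq n (f n) n (hf n) (by simp))
  · constructor
    · intro h
      have h1 : f g = 1 := h
      simpa [h1] using hf g
    · intro h
      exact congrArg Additive.ofMul (huniq g (f g) 1 (hf g) (by simpa using h))

/-- A subgroup supplementing an abelian minimal normal subgroup is everything or a complement. -/
theorem eq_top_or_inf_eq_bot_of_sup_eq_top (N K : Subgroup G) [N.Normal] [IsMulCommutative N]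
    (hmin : ∀ M : Subgroup G, M.Normal → M ≤ N → M = ⊥ ∨ M = N) (hsup : N ⊔ K = ⊤) :
    K = ⊤ ∨ N ⊓ K = ⊥ := by
  -- K normalises the intersection and the abelian N centralises it.
  have hnormal : (N ⊓ K).Normal := ⟨fun x hx g => by
    have hg : g ∈ K ⊔ N := by rw [sup_comm, hsup]; trivial
    rw [← SetLike.mem_coe, Subgroup.mul_normal, Set.mem_mul] at hg
    obtain ⟨k, hk, n, hn, rfl⟩ := hg
    have hc : n * x * n⁻¹ = x := by
      rw [setLike_mul_comm hn hx.1, mul_inv_cancel_right]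
    have he : k * n * x * (k * n)⁻¹ = k * x * k⁻¹ := by
      conv_rhs => rw [← hc]
      group
    rw [he]
    exact ⟨Subgroup.Normal.conj_mem inferInstance x hx.1 k,
      K.mul_mem (K.mul_mem hk hx.2) (K.inv_mem hk)⟩⟩
  rcases hmin _ hnormal inf_le_left with h | h
  · exact Or.inr h
  · left
    rw [← hsup, right_eq_sup]
    exact inf_eq_left.1 h

/-- By counting: if every lift failed, there would be |N|^2 + 1 derivations. -/
theorem exists_closure_pair_eq_top_of_quotient [Finite G] [Group.IsSolvable G]
    (hG : IsCoprimelyInvariablyGenerated G) (N : Subgroup G) [N.Normal] [IsMulCommutative N]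
    {p : ℕ} (hp : p.Prime) (hN : N ≠ ⊥) (hexp : ∀ n ∈ N, n ^ p = 1)
    (hmin : ∀ M : Subgroup G, M.Normal → M ≤ N → M = ⊥ ∨ M = N) {a b : G}
    (hab : N ⊔ Subgroup.closure {a, b} = ⊤) :
    ∃ m n : N, Subgroup.closure {a * m, b * n} = (⊤ : Subgroup G) := by
  by_contra! hcon
  let := conjDistribMulAction N
  have hsup : ∀ m n : N, N ⊔ Subgroup.closure {a * m, b * n} = ⊤ := by
    intro m n
    rw [← top_le_iff, ← hab]
    refine sup_le le_sup_left ((Subgroup.closure_le _).2 ?_)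
    have key : ∀ (c : G) (r : N), c * r ∈ ({a * m, b * n} : Set G) →
        c ∈ N ⊔ Subgroup.closure {a * m, b * n} := fun c r h => by
      have h' := mul_mem (Subgroup.mem_sup_right (S := N) (Subgroup.subset_closure h))
        (Subgroup.mem_sup_left (inv_mem r.2))
      rwa [mul_inv_cancel_right] at h'
    rintro c (rfl | rfl)
    · exact key _ m (Or.inl rfl)
    · exact key _ n (Or.inr rfl)
  have hder := fun m n : N => exists_derivation_of_isComplement N _ (hsup m n)
    ((eq_top_or_inf_eq_bot_of_sup_eq_top N _ hmin (hsup m n)).resolve_left (hcon m n))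
  choose d hd hdN hdK using hder
  obtain ⟨z, hz⟩ := Subgroup.ne_bot_iff_exists_ne_one.1 hN
  -- Each derivation has at most one zero in a coset of N, so it determines its pair (m, n).
  have hmul : ∀ m n : N, ∀ (c : G) (r s : N), d m n (c * r) = 0 → d m n (c * s) = 0 → r = s := by
    intro m n c r s hr hs
    have h : d m n (c * r) = d m n (c * s) := hr.trans hs.symm
    rw [derivations.map_mul (hd m n), derivations.map_mul (hd m n), hdN, hdN] at h
    exact Additive.ofMul.injective (MulAction.injective c (add_left_cancel h))
  -- `none` goes to the zero derivation, the extra one that breaks the bound.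
  let F : Option (N × N) → derivations G (Additive N) := fun o =>
    o.elim 0 fun r => ⟨d r.1 r.2, hd r.1 r.2⟩
  have hne : ∀ m n : N, d m n ≠ 0 := fun m n h => hz <| by
    have h' := hdN m n z
    rw [h] at h'
    exact (Additive.ofMul.injective h').symm
  have hF : Function.Injective F := by
    rintro (_ | ⟨m, n⟩) (_ | ⟨m', n'⟩) h
    · rfl
    · exact absurd (congrArg Subtype.val h).symm (hne m' n')
    · exact absurd (congrArg Subtype.val h) (hne m n)
    · have h' : d m n = d m' n' := congrArg Subtype.val h
      have hm : m = m' := hmul m n a m m'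
        ((hdK m n _).2 (Subgroup.subset_closure (Or.inl rfl)))
        (by rw [h']; exact (hdK m' n' _).2 (Subgroup.subset_closure (Or.inl rfl)))
      have hn : n = n' := hmul m n b n n'
        ((hdK m n _).2 (Subgroup.subset_closure (Or.inr rfl)))
        (by rw [h']; exact (hdK m' n' _).2 (Subgroup.subset_closure (Or.inr rfl)))
      rw [hm, hn]
  have hle := card_derivations_le (V := Additive N) hp
    (fun v => Additive.toMul.injective (Subtype.ext (hexp _ v.toMul.2))) (fun W hW => ?_) hG
  · have hcard := Nat.card_le_card_of_injective F hF
    rw [Finite.card_option, Nat.card_prod] at hcard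
    have hVN : Nat.card (Additive N) = Nat.card N := rfl
    rw [hVN, sq] at hle
    omega
  · let M : Subgroup G := (AddSubgroup.toSubgroup' W).map N.subtype
    have hM : M.Normal := ⟨by
      rintro _ ⟨w, hw, rfl⟩ g
      exact ⟨MulAut.conjNormal g w, hW g (Additive.ofMul w) hw, MulAut.conjNormal_apply g w⟩⟩
    rcases hmin M hM (Subgroup.map_subtype_le _) with h | h
    · left
      rw [AddSubgroup.eq_bot_iff_forall]
      intro w hw
      have hwM : ((w.toMul : N) : G) ∈ M := ⟨w.toMul, hw, rfl⟩
      rw [h, Subgroup.mem_bot, OneMemClass.coe_eq_one] at hwM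
      exact hwM
    · right
      rw [AddSubgroup.eq_top_iff']
      intro w
      have hwM : ((w.toMul : N) : G) ∈ M := by rw [h]; exact w.toMul.2
      obtain ⟨u, hu, huw⟩ := hwM
      obtain rfl : Additive.ofMul u = w := congrArg Additive.ofMul (Subtype.ext huw)
      exact hu

end Lifting

theorem exists_closure_pair_eq_top {G : Type*} [Group G] [Finite G] [Group.IsSolvable G]
    (hG : IsCoprimelyInvariablyGenerated G) :
    ∃ a b : G, Subgroup.closure {a, b} = (⊤ : Subgroup G) := by
  induction hn : Nat.card G using Nat.strong_induction_on generalizing G with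
  | _ n ih =>
    rcases subsingleton_or_nontrivial G with hsub | hnt
    · exact ⟨1, 1, Subsingleton.elim _ _⟩
    obtain ⟨N, p, hnorm, hp, hbot, hcomm, hexp, hmin⟩ :=
      exists_minimal_normal_elementary_abelian G
    have hlt : Nat.card (G ⧸ N) < n := by
      rw [← hn, Subgroup.card_eq_card_quotient_mul_card_subgroup N]
      exact lt_mul_of_one_lt_right Nat.card_pos (N.one_lt_card_iff_ne_bot.2 hbot)
    obtain ⟨a', b', hab⟩ := ih _ hlt
      (hG.of_surjective (QuotientGroup.mk' N) (QuotientGroup.mk'_surjective N)) rfl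
    obtain ⟨a, rfl⟩ := QuotientGroup.mk'_surjective N a'
    obtain ⟨b, rfl⟩ := QuotientGroup.mk'_surjective N b'
    have hsup : N ⊔ Subgroup.closure {a, b} = ⊤ := by
      rw [← Set.image_pair, ← MonoidHom.map_closure] at hab
      have h := congrArg (Subgroup.comap (QuotientGroup.mk' N)) hab
      rwa [Subgroup.comap_map_eq, QuotientGroup.ker_mk', Subgroup.comap_top, sup_comm] at h
    obtain ⟨m, k, h⟩ := exists_closure_pair_eq_top_of_quotient hG N hp hbot hexp hmin hsup
    exact ⟨_, _, h⟩

theorem mainTheorem2 (G : Type*) [Group G] [Finite G] [Group.IsSolvable G]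
    (hG : IsCoprimelyInvariablyGenerated G) : Group.rank G ≤ 2 := by
  classical
  obtain ⟨a, b, hab⟩ := exists_closure_pair_eq_top hG
  exact (Group.rank_le (S := {a, b}) (by rwa [Finset.coe_pair])).trans Finset.card_le_two
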